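/- Let $\mathbb U_1$ be the Urysohn sphere, i.e. the (unique up to isometry) complete separable metric space of diameter $1$ that is finitely injective: for all finite metric spaces $K\subseteq L$ with $\operatorname{diam} L\le 1$, every isometric embedding $K\to\mathbb U_1$ extends to an isometric embedding $L\to\mathbb U_1$. Let $G=\operatorname{Iso}(\mathbb U_1)$ be the group of all isometries of $\mathbb U_1$ onto itself with the topology of pointwise convergence. An equivariant compactification of a $G$-space $X$ is a continuous $G$-equivariant map $\nu\colon X\to K$ with dense image into a compact Hausdorff space $K$ with a continuous $G$-action; $\nu$ is not required to be injective. Two of them, $\nu\colon X\to K$ and $\nu'\colon X\to K'$, are equivalent if there is a $G$-equivariant homeomorphism $e\colon K\to K'$ with $e\circ\nu=\nu'$. Let $\operatorname{RUC}_G(X)$ be the algebra of all bounded continuous $f\colon X\to\mathbb R$ such that for each $\varepsilon>0$ there is a neighbourhood $V$ of the identity of $G$ with $\sup_{x\in X}|f(vx)-f(x)|<\varepsilon$ for all $v\in V$, and let $\beta_G\colon X\to\beta_GX$ be the evaluation map into the Gelfand space (the space of maximal ideals, equivalently of real characters) of $\operatorname{RUC}_G(X)$. The Gromov compactification $\gamma\colon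 X\to\gamma X$ of a metric space $(X,d)$ is the Samuel compactification of $X$ for the initial uniformity generated by the functions $d(\cdot,z)$, $z\in X$; that is, the completion of $X$ for the finest totally bounded uniformity coarser than that one. An isometric action on $X$ extends to $\gamma X$. **Theorem 3.5.** The greatest equivariant compactification of the $G$-space $\mathbb U_1$ is the Gromov compactification of $\mathbb U_1$: both $\gamma\colon\mathbb U_1\to\gamma\mathbb U_1$ and $\beta_G\colon\mathbb U_1\to\beta_G\mathbb U_1$ are equivariant compactifications through which every equivariant compactification of $\mathbb U_1$ factors by a continuous $G$-equivariant map, and they are equivalent. In particular, $\beta_G\mathbb U_1$ is metrizable, and $\operatorname{RUC}_G(\mathbb U_1)$ is the closed unital subalgebra, in the algebra of bounded continuous real functions on $\mathbb U_1$ with the supremum norm, generated by the functions $d(\cdot,z)$, $z\in\mathbb U_1$. -/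

import Mathlib

open Set Filter Topology

open scoped BoundedContinuousFunction

universe u v w t

namespace Urys

/-! ### The isometry group with the topology of pointwise convergence -/

section Iso

variable {X : Type u} [MetricSpace X]

/-- The group of all isometries of `X` onto itself. -/
abbrev Iso (X : Type u) [MetricSpace X] : Type u := X ≃ᵢ X

/-- The natural action of the isometry group, `g • x = g x`. -/
instance instMulActionIso : MulAction (Iso X) X where
  smul g x := g x
  one_smul _ := rfl
  mul_smul _ _ _ := rfl

theorem iso_smul_def (g : Iso X) (x : X) : g • x = g x := rfl

/-- The topology of pointwise convergence on the isometry group: the topology induced by the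
inclusion of `Iso X` in the product space `X → X`. -/
instance instTopologicalSpaceIso : TopologicalSpace (Iso X) :=
  TopologicalSpace.induced (fun (g : Iso X) (x : X) => g x) inferInstance

instance instIsIsometricSMulIso : IsIsometricSMul (Iso X) X where
  isometry_smul g := g.isometry

theorem iso_continuous_eval (x : X) : Continuous fun g : Iso X => g x :=
  (continuous_apply x).comp continuous_induced_dom

theorem iso_continuous_iff {Y : Type*} [TopologicalSpace Y] {f : Y → Iso X} :
    Continuous f ↔ ∀ x, Continuous fun y => f y x := by
  rw [continuous_induced_rng, continuous_pi_iff]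
  rfl

instance instContinuousSMulIso : ContinuousSMul (Iso X) X where
  continuous_smul := by
    rw [continuous_iff_continuousAt]
    rintro ⟨g, x⟩
    rw [ContinuousAt, tendsto_iff_dist_tendsto_zero]
    have h1 : Tendsto (fun p : Iso X × X => dist p.2 x + dist (p.1 x) (g x)) (𝓝 (g, x)) (𝓝 0) := by
      have hc : Continuous fun p : Iso X × X => dist p.2 x + dist (p.1 x) (g x) :=
        (continuous_snd.dist continuous_const).add
          (((iso_continuous_eval x).comp continuous_fst).dist continuous_const)
      simpa using hc.tendsto (g, x)
    refine squeeze_zero (fun _ => dist_nonneg) (fun p => ?_) h1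
    have h2 := dist_triangle (p.1 • p.2) (p.1 • x) (g • x)
    rw [dist_smul] at h2
    exact h2

instance instIsTopologicalGroupIso : IsTopologicalGroup (Iso X) where
  continuous_mul := by
    rw [iso_continuous_iff]
    intro x
    exact continuous_fst.smul ((iso_continuous_eval x).comp continuous_snd)
  continuous_inv := by
    rw [iso_continuous_iff]
    intro x
    rw [continuous_iff_continuousAt]
    intro g
    rw [ContinuousAt, tendsto_iff_dist_tendsto_zero]
    have hc : Continuous fun h : Iso X => dist x (h (g⁻¹ x)) :=
      continuous_const.dist (iso_continuous_eval _)
    have h0 : dist x (g (g⁻¹ x)) = 0 := by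
      rw [dist_eq_zero]
      exact (smul_inv_smul g x).symm
    have h1 := hc.tendsto g
    simp only [h0] at h1
    refine h1.congr fun h => ?_
    have h2 := dist_smul h (h⁻¹ • x) (g⁻¹ • x)
    rw [smul_inv_smul] at h2
    exact h2

end Iso

/-! ### Equivariant compactifications -/

section Compactifications

variable (G : Type w) [Group G] [TopologicalSpace G]
variable {X : Type u} [TopologicalSpace X] [MulAction G X]

/-- `ν : X → K` is an equivariant compactification of the `G`-space `X`: `K` is a compact Hausdorff
space with a (jointly) continuous action of `G`, and `ν` is a continuous equivariant map with dense
image. The map `ν` is not required to be injective. -/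
structure IsEquivariantCompactification {K : Type v} [TopologicalSpace K] [MulAction G K]
    (ν : X → K) : Prop where
  compactSpace : CompactSpace K
  t2Space : T2Space K
  continuousSMul : ContinuousSMul G K
  continuous : Continuous ν
  equivariant : ∀ (g : G) (x : X), ν (g • x) = g • ν x
  denseRange : DenseRange ν

/-- `β : X → B` is a greatest equivariant compactification: it is an equivariant compactification
through which every equivariant compactification `μ : X → K` (with `K` in the universe `v`)
factors by a continuous equivariant map. -/
def IsGreatestEquivariantCompactification {B : Type t} [TopologicalSpace B] [MulAction G B]
    (β : X → B) : Prop :=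
  IsEquivariantCompactification G β ∧
    ∀ (K : Type v) [TopologicalSpace K] [MulAction G K] (μ : X → K),
      IsEquivariantCompactification G μ →
        ∃ φ : B → K, Continuous φ ∧ (∀ (g : G) (b : B), φ (g • b) = g • φ b) ∧
          ∀ x, φ (β x) = μ x

/-- Equivalence of two equivariant compactifications of `X`: an equivariant homeomorphism
commuting with the maps from `X`. -/
def EquivalentCompactifications {B K : Type*} [TopologicalSpace B] [MulAction G B]
    [TopologicalSpace K] [MulAction G K] (β : X → B) (γ : X → K) : Prop :=
  ∃ e : B ≃ₜ K, (∀ (g : G) (b : B), e (g • b) = g • e b) ∧ ∀ x, e (β x) = γ x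

end Compactifications

/-! ### Right uniformly continuous functions and the greatest equivariant compactification -/

section RUC

variable (G : Type w) [Group G] [TopologicalSpace G]
variable (X : Type u) [TopologicalSpace X] [MulAction G X]

/-- The algebra of right uniformly continuous functions: the bounded continuous real functions `f`
such that for each `ε > 0` there is a neighbourhood `V` of the identity of `G` with
`|f (v x) - f x| < ε` for all `v ∈ V` and all `x`. -/
def RUC : Subalgebra ℝ (X →ᵇ ℝ) where
  carrier := {f | ∀ ε > 0, ∃ V ∈ 𝓝 (1 : G), ∀ v ∈ V, ∀ x, |f (v • x) - f x| < ε}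
  algebraMap_mem' r := by
    intro ε hε
    exact ⟨univ, univ_mem, fun v _ x => by simpa using hε⟩
  add_mem' := by
    intro f g hf hg ε hε
    obtain ⟨V, hV, hfV⟩ := hf (ε / 2) (half_pos hε)
    obtain ⟨W, hW, hgW⟩ := hg (ε / 2) (half_pos hε)
    refine ⟨V ∩ W, inter_mem hV hW, fun v hv x => ?_⟩
    have h1 := abs_lt.1 (hfV v hv.1 x)
    have h2 := abs_lt.1 (hgW v hv.2 x)
    simp only [BoundedContinuousFunction.coe_add, Pi.add_apply]
    rw [abs_lt]
    constructor <;> linarith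
  mul_mem' := by
    intro f g hf hg ε hε
    have hM : 0 < ‖f‖ + ‖g‖ + 1 := by positivity
    obtain ⟨V, hV, hfV⟩ := hf (ε / (‖f‖ + ‖g‖ + 1)) (div_pos hε hM)
    obtain ⟨W, hW, hgW⟩ := hg (ε / (‖f‖ + ‖g‖ + 1)) (div_pos hε hM)
    refine ⟨V ∩ W, inter_mem hV hW, fun v hv x => ?_⟩
    have h1 := hfV v hv.1 x
    have h2 := hgW v hv.2 x
    have h3 : |f (v • x)| ≤ ‖f‖ := f.norm_coe_le_norm _
    have h4 : |g x| ≤ ‖g‖ := g.norm_coe_le_norm _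
    simp only [BoundedContinuousFunction.coe_mul, Pi.mul_apply]
    have h5 : f (v • x) * g (v • x) - f x * g x =
        f (v • x) * (g (v • x) - g x) + (f (v • x) - f x) * g x := by ring
    rw [h5]
    set η := ε / (‖f‖ + ‖g‖ + 1) with hη
    have hηpos : 0 < η := div_pos hε hM
    have h6 : η * (‖f‖ + ‖g‖ + 1) = ε := div_mul_cancel₀ _ hM.ne'
    calc _ ≤ |f (v • x) * (g (v • x) - g x)| + |(f (v • x) - f x) * g x| := abs_add_le _ _
      _ = |f (v • x)| * |g (v • x) - g x| + |f (v • x) - f x| * |g x| := by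
          rw [abs_mul, abs_mul]
      _ ≤ ‖f‖ * η + η * ‖g‖ := by gcongr
      _ < ε := by linarith

variable {G X}

theorem mem_RUC {f : X →ᵇ ℝ} :
    f ∈ RUC G X ↔ ∀ ε > 0, ∃ V ∈ 𝓝 (1 : G), ∀ v ∈ V, ∀ x, |f (v • x) - f x| < ε :=
  Iff.rfl

/-- The translate `x ↦ f (g x)` of a bounded continuous function. -/
noncomputable def precomp [ContinuousConstSMul G X] (g : G) (f : X →ᵇ ℝ) : X →ᵇ ℝ :=
  f.compContinuous ⟨fun x => g • x, continuous_const_smul g⟩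

theorem precomp_mem [IsTopologicalGroup G] [ContinuousConstSMul G X] (g : G) {f : X →ᵇ ℝ}
    (hf : f ∈ RUC G X) : precomp g f ∈ RUC G X := by
  intro ε hε
  obtain ⟨V, hV, hfV⟩ := hf ε hε
  have hc : Continuous fun v : G => g * v * g⁻¹ := by fun_prop
  have ht : Tendsto (fun v : G => g * v * g⁻¹) (𝓝 1) (𝓝 1) := by
    simpa using hc.tendsto 1
  refine ⟨_, ht hV, fun v hv x => ?_⟩
  have h := hfV _ hv (g • x)
  change |f (g • v • x) - f (g • x)| < ε
  have h2 : (g * v * g⁻¹) • g • x = g • v • x := by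
    rw [smul_smul, smul_smul, inv_mul_cancel_right]
  rwa [h2] at h

/-- The translation `f ↦ (x ↦ f (g x))` as a continuous linear operator on the algebra of right
uniformly continuous functions. -/
noncomputable def precompRUC [IsTopologicalGroup G] [ContinuousConstSMul G X] (g : G) :
    RUC G X →L[ℝ] RUC G X where
  toFun f := ⟨precomp g f, precomp_mem g f.2⟩
  map_add' _ _ := rfl
  map_smul' _ _ := rfl
  cont := ((BoundedContinuousFunction.continuous_compContinuous _).comp
    continuous_subtype_val).subtype_mk _

theorem precompRUC_apply [IsTopologicalGroup G] [ContinuousConstSMul G X] (g : G) (f : RUC G X)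
    (x : X) : (precompRUC g f : X →ᵇ ℝ) x = (f : X →ᵇ ℝ) (g • x) := rfl

theorem precompRUC_mul_apply [IsTopologicalGroup G] [ContinuousConstSMul G X] (g : G)
    (f f' : RUC G X) : precompRUC g (f * f') = precompRUC g f * precompRUC g f' := rfl

theorem precompRUC_one_apply [IsTopologicalGroup G] [ContinuousConstSMul G X] (g : G) :
    precompRUC g (1 : RUC G X) = 1 := rfl

variable (G X)

/-- The compactum `β_G X` that corresponds to the algebra `RUC G X`: its Gelfand space, that is, the
space of real characters of the algebra (equivalently, of its maximal ideals) with the topology of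
pointwise convergence. -/
abbrev BetaG : Type u := WeakDual.characterSpace ℝ (RUC G X)

variable {G X}

/-- The action of `G` on characters, `(g φ)(f) = φ (g⁻¹ f)`, where `(g⁻¹ f)(x) = f (g x)`. -/
noncomputable instance instMulActionBetaG [IsTopologicalGroup G] [ContinuousConstSMul G X] :
    MulAction G (BetaG G X) where
  smul g φ := ⟨(WeakDual.CharacterSpace.toCLM φ).comp (precompRUC g), by
    refine ⟨fun h => ?_, fun f f' => ?_⟩
    · have h1 : φ (precompRUC g (1 : RUC G X)) = 0 := DFunLike.congr_fun h (1 : RUC G X)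
      rw [precompRUC_one_apply, map_one] at h1
      exact one_ne_zero h1
    · change φ (precompRUC g (f * f')) = φ (precompRUC g f) * φ (precompRUC g f')
      rw [precompRUC_mul_apply, map_mul]⟩
  one_smul φ := by
    ext f
    change φ (precompRUC 1 f) = φ f
    congr 1
    ext x
    rw [precompRUC_apply, one_smul]
  mul_smul g h φ := by
    ext f
    change φ (precompRUC (g * h) f) = φ (precompRUC h (precompRUC g f))
    congr 1
    ext x
    rw [precompRUC_apply, precompRUC_apply, precompRUC_apply, mul_smul]

theorem betaG_smul_apply [IsTopologicalGroup G] [ContinuousConstSMul G X] (g : G) (φ : BetaG G X)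
    (f : RUC G X) : (g • φ) f = φ (precompRUC g f) := rfl

variable (G)

/-- The canonical map `β_G : X → β_G X`, sending `x` to the evaluation at `x`. -/
noncomputable def betaMap (x : X) : BetaG G X :=
  ⟨(BoundedContinuousFunction.evalCLM ℝ x).comp (RUC G X).toSubmodule.subtypeL, by
    refine ⟨fun h => ?_, fun _ _ => rfl⟩
    have h1 : (1 : ℝ) = 0 := DFunLike.congr_fun h (1 : RUC G X)
    exact one_ne_zero h1⟩

theorem betaMap_apply (x : X) (f : RUC G X) : betaMap G x f = (f : X →ᵇ ℝ) x := rfl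

end RUC

/-! ### The Gromov compactification -/

section Gromov

/-- The precompact replica of a uniformity: the finest of the totally bounded uniformities that are
coarser than it. In Mathlib's order on uniformities `𝒰 ≤ 𝒱` means that `𝒱` is coarser than `𝒰`. -/
abbrev precompactReplica {X : Type u} (𝒰 : UniformSpace X) : UniformSpace X :=
  sInf {𝒱 | 𝒰 ≤ 𝒱 ∧ @TotallyBounded X 𝒱 univ}

theorem precompactReplica_isLeast {X : Type u} (𝒰 : UniformSpace X) :
    IsLeast {𝒱 | 𝒰 ≤ 𝒱 ∧ @TotallyBounded X 𝒱 univ} (precompactReplica 𝒰) := by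
  refine ⟨⟨le_sInf fun 𝒱 h => h.1, ?_⟩, fun 𝒱 h => sInf_le h⟩
  rw [@totallyBounded_iff_ultrafilter X (precompactReplica 𝒰)]
  intro F _
  refine ⟨F.neBot, ?_⟩
  rw [precompactReplica, sInf_eq_iInf, iInf_uniformity]
  refine le_iInf fun 𝒱 => ?_
  rw [iInf_uniformity]
  refine le_iInf fun h => ?_
  exact ((@totallyBounded_iff_ultrafilter X 𝒱 univ).1 h.2 F (by simp)).2

/-- The `d`-weak uniformity of a metric space: the initial uniformity generated by the functions
`x ↦ d(x, z)`, `z ∈ X`. -/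
abbrev dWeakUniformity (X : Type u) [MetricSpace X] : UniformSpace X :=
  ⨅ z : X, UniformSpace.comap (fun x => dist x z) inferInstance

/-- The set `X` endowed with the precompact replica of its `d`-weak uniformity. -/
def PrecompactWeak (X : Type u) [MetricSpace X] : Type u := X

variable (X : Type u) [MetricSpace X]

instance instUniformSpacePrecompactWeak : UniformSpace (PrecompactWeak X) :=
  precompactReplica (dWeakUniformity X)

/-- The Gromov compactification `γX`: the Samuel compactification of `X` with its `d`-weak
uniformity, that is, the (Hausdorff) completion of the precompact replica of that uniformity. -/
abbrev GromovCompactification : Type u := UniformSpace.Completion (PrecompactWeak X)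

variable {X}

/-- The canonical map `γ : X → γX`. -/
def gromovMap (x : X) : GromovCompactification X :=
  UniformSpace.Completion.coe' (α := PrecompactWeak X) x

variable {G : Type w} [Group G] [MulAction G X]

instance instMulActionPrecompactWeak : MulAction G (PrecompactWeak X) :=
  inferInstanceAs (MulAction G X)

theorem dWeakUniformity_le_comap [IsIsometricSMul G X] (g : G) :
    dWeakUniformity X ≤ UniformSpace.comap (fun x : X => g • x) (dWeakUniformity X) := by
  rw [dWeakUniformity, UniformSpace.comap_iInf]
  refine le_iInf fun z => ?_
  refine (iInf_le _ (g⁻¹ • z)).trans (le_of_eq ?_)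
  rw [← UniformSpace.comap_comap]
  congr 1
  funext x
  change dist x (g⁻¹ • z) = dist (g • x) z
  rw [← dist_smul g x, smul_inv_smul]

/-- Isometries of `X` are uniformly continuous for the precompact replica of the `d`-weak
uniformity; so an isometric action on `X` extends to the completion `γX`, through Mathlib's action on
completions. -/
instance instUniformContinuousConstSMulPrecompactWeak [IsIsometricSMul G X] :
    UniformContinuousConstSMul G (PrecompactWeak X) where
  uniformContinuous_const_smul g := by
    rw [uniformContinuous_iff_le_comap]
    change precompactReplica (dWeakUniformity X) ≤
      UniformSpace.comap (fun x : X => g • x) (precompactReplica (dWeakUniformity X))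
    have hR := (precompactReplica_isLeast (dWeakUniformity X)).1
    refine (precompactReplica_isLeast (dWeakUniformity X)).2
      ⟨(dWeakUniformity_le_comap g).trans (UniformSpace.comap_mono hR.1), ?_⟩
    have hi : @IsUniformInducing X X
        (UniformSpace.comap (fun x : X => g • x) (precompactReplica (dWeakUniformity X)))
        (precompactReplica (dWeakUniformity X)) (fun x : X => g • x) :=
      @IsUniformInducing.mk _ _ (_) (_) _ rfl
    have h := @totallyBounded_preimage X X
      (UniformSpace.comap (fun x : X => g • x) (precompactReplica (dWeakUniformity X)))
      (precompactReplica (dWeakUniformity X)) _ _ hi hR.2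
    simpa using h

variable (X)

/-- The set `X^d` of elementary Katětov functions `d(·, z)`, `z ∈ X`, as bounded continuous functions
(for a bounded metric these are all the distance functions to points). -/
def elementaryKatetov : Set (X →ᵇ ℝ) := {f | ∃ z : X, ∀ x, f x = dist x z}

/-- `Gro(X)`: the closed unital subalgebra of `CB(X)` generated by the elementary Katětov
functions. -/
noncomputable def Gro : Subalgebra ℝ (X →ᵇ ℝ) :=
  (Algebra.adjoin ℝ (elementaryKatetov X)).topologicalClosure

end Gromov

/-! ### The Urysohn sphere -/

/-- Finite injectivity: for every finite metric space `L` of diameter at most that of `X` and every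
subspace `K` of `L`, each isometric embedding of `K` in `X` extends to one of `L`. (Every finite
metric space is isometric to one whose underlying type lies in `Type`.) -/
def FinitelyInjective (X : Type u) [MetricSpace X] : Prop :=
  ∀ (L : Type) [Finite L] [MetricSpace L],
    Metric.ediam (univ : Set L) ≤ Metric.ediam (univ : Set X) →
      ∀ (K : Set L) (φ : K → X), Isometry φ →
        ∃ Φ : L → X, Isometry Φ ∧ ∀ k : K, Φ k = φ k

/-- The Urysohn sphere `𝕌₁`, determined up to isometry: a complete separable (Polish), finitely
injective metric space of diameter `1`. -/
structure IsUrysohnSphere (X : Type u) [MetricSpace X] : Prop where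
  complete : CompleteSpace X
  separable : TopologicalSpace.SeparableSpace X
  diam_eq_one : Metric.ediam (univ : Set X) = 1
  finitelyInjective : FinitelyInjective X

end Urys

/-! The heart is a quantitative homogeneity of the sphere,
`IsUrysohnSphere.exists_isometryEquiv_moving`: points `x`, `y` whose distances to finitely many `z
i` differ by at most `δ` are exchanged by an isometry that moves each `z i` by at most `δ`. It comes
from realizing a finite amalgam inside `X` and extending the resulting finite partial isometry by
back-and-forth.

Consequently, if `f` is right uniformly continuous and `x`, `y` are close for the `d`-weak
uniformity, then `y = g x` with `g` near the identity, so `f x` and `f y` are close. Hence `f` is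
uniformly continuous for that uniformity and extends to `γX`. Conversely, Stone–Weierstrass on `γX`
puts restrictions of continuous functions in `Gro X`, and `Gro X` lies in `RUC` because `|d(vx, z) -
d(x, z)| ≤ d(vz, z)`. This identifies the two algebras.

For every `G`-space, `β_G X` is greatest, since continuous functions on an equivariant
compactification pull back into `RUC`. As `γX` and `β_G X` induce the same functions on `X`, they
are equivalent, and maximality passes to `γX` while metrizability passes back to `β_G X`. -/

namespace Urys

/-! ### Homogeneity of the Urysohn sphere. -/

section Homogeneity

variable {X : Type u} [MetricSpace X]

theorem IsUrysohnSphere.dist_le_one (hX : IsUrysohnSphere X) (x y : X) : dist x y ≤ 1 := by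
  have h : edist x y ≤ 1 := by
    rw [← hX.diam_eq_one]
    exact Metric.edist_le_ediam_of_mem (mem_univ x) (mem_univ y)
  rw [edist_dist, ← ENNReal.ofReal_one] at h
  exact (ENNReal.ofReal_le_ofReal_iff zero_le_one).1 h

theorem IsUrysohnSphere.nonempty (hX : IsUrysohnSphere X) : Nonempty X := by
  by_contra h
  rw [not_nonempty_iff] at h
  have h1 := hX.diam_eq_one
  rw [univ_eq_empty_iff.2 h, Metric.ediam_empty] at h1
  exact zero_ne_one h1

/-- Finite injectivity for finite pseudometric spaces. -/
theorem IsUrysohnSphere.exists_isometry_extending (hX : IsUrysohnSphere X) {I : Type} [Finite I]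
    [PseudoMetricSpace I] (hI : ∀ i j : I, dist i j ≤ 1) (K : Set I) (φ : I → X)
    (hφ : ∀ i ∈ K, ∀ j ∈ K, dist (φ i) (φ j) = dist i j) :
    ∃ Φ : I → X, Isometry Φ ∧ ∀ k ∈ K, Φ k = φ k := by
  have hd : Metric.ediam (univ : Set (SeparationQuotient I)) ≤ Metric.ediam (univ : Set X) := by
    rw [hX.diam_eq_one]
    refine Metric.ediam_le fun p _ q _ => ?_
    obtain ⟨i, rfl⟩ := SeparationQuotient.surjective_mk p
    obtain ⟨j, rfl⟩ := SeparationQuotient.surjective_mk q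
    rw [edist_dist, SeparationQuotient.dist_mk, ← ENNReal.ofReal_one]
    exact ENNReal.ofReal_le_ofReal (hI i j)
  have : Finite (SeparationQuotient I) :=
    Finite.of_surjective _ SeparationQuotient.surjective_mk
  -- The choice of representatives `r` is harmless: by `hφ`, `φ` agrees on points of `K` at distance
  -- zero.
  choose r hrK hr using fun p : SeparationQuotient.mk '' K => p.2
  obtain ⟨Ψ, hΨ, hΨφ⟩ := hX.finitelyInjective (SeparationQuotient I) hd
    (SeparationQuotient.mk '' K) (fun p => φ (r p)) (Isometry.of_dist_eq fun p q => by
      rw [hφ _ (hrK p) _ (hrK q), ← SeparationQuotient.dist_mk, hr, hr, Subtype.dist_eq])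
  refine ⟨fun i => Ψ (SeparationQuotient.mk i), Isometry.of_dist_eq fun i j => by
    rw [hΨ.dist_eq, SeparationQuotient.dist_mk], fun k hk => ?_⟩
  refine (hΨφ ⟨_, mem_image_of_mem _ hk⟩).trans ?_
  rw [← dist_eq_zero, hφ _ (hrK _) _ hk,
    ← SeparationQuotient.dist_mk, hr, dist_self]

/-- A relation on `X` that is a partial isometry. -/
def IsometricRel (R : Set (X × X)) : Prop :=
  ∀ p ∈ R, ∀ q ∈ R, dist p.1 q.1 = dist p.2 q.2

theorem IsometricRel.closure {R : Set (X × X)} (hR : IsometricRel R) :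
    IsometricRel (closure R) := by
  have hc : IsClosed {z : (X × X) × (X × X) | dist z.1.1 z.2.1 = dist z.1.2 z.2.2} :=
    isClosed_eq (by fun_prop) (by fun_prop)
  have hs : R ×ˢ R ⊆ {z : (X × X) × (X × X) | dist z.1.1 z.2.1 = dist z.1.2 z.2.2} :=
    fun z hz => hR _ hz.1 _ hz.2
  intro p hp q hq
  have h := closure_minimal hs hc
  rw [closure_prod_eq] at h
  exact h (mk_mem_prod hp hq)

theorem IsometricRel.swap {R : Set (X × X)} (hR : IsometricRel R) :
    IsometricRel (Prod.swap ⁻¹' R) := fun _ hp _ hq => (hR _ hp _ hq).symm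

/-- For the sup metric on `X × X`, the first projection is isometric on `R`. Since `R` is complete,
its projection is closed; being dense, it is everything. -/
theorem IsometricRel.exists_mem_of_dense [CompleteSpace X] {R : Set (X × X)} (hR : IsometricRel R)
    (hc : IsClosed R) (hd : Dense (Prod.fst '' R)) (x : X) : ∃ y, (x, y) ∈ R := by
  have : CompleteSpace R := hc.completeSpace_coe
  have hi : Isometry fun p : R => p.1.1 := Isometry.of_dist_eq fun p q => by
    rw [Subtype.dist_eq, Prod.dist_eq, ← hR _ p.2 _ q.2, max_self]
  have hcl : IsClosed (range fun p : R => p.1.1) := hi.isClosedEmbedding.isClosed_range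
  have he : (range fun p : R => p.1.1) = Prod.fst '' R := by
    ext z
    simp
  rw [he] at hcl
  have hx : x ∈ Prod.fst '' R := by
    rw [← hcl.closure_eq]
    exact hd x
  obtain ⟨p, hp, rfl⟩ := hx
  exact ⟨p.2, hp⟩

/-- A partial isometry with dense domain and range extends to a surjective isometry. -/
theorem IsometricRel.exists_isometryEquiv [CompleteSpace X] {R : Set (X × X)}
    (hR : IsometricRel R) (h1 : Dense (Prod.fst '' R)) (h2 : Dense (Prod.snd '' R)) :
    ∃ g : X ≃ᵢ X, ∀ p ∈ R, g p.1 = p.2 := by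
  have hC := hR.closure
  -- The closed relation is functional in both directions, so the chosen `f` and `f'` are mutually
  -- inverse.
  have huniq : ∀ p ∈ _root_.closure R, ∀ q ∈ _root_.closure R, p.1 = q.1 ↔ p.2 = q.2 := by
    intro p hp q hq
    rw [← dist_eq_zero, hC p hp q hq, dist_eq_zero]
  choose f hf using hC.exists_mem_of_dense isClosed_closure
    (h1.mono (image_mono subset_closure))
  choose f' hf' using hC.swap.exists_mem_of_dense (isClosed_closure.preimage continuous_swap) (by
    refine h2.mono ?_
    rintro _ ⟨p, hp, rfl⟩
    exact ⟨p.swap, subset_closure hp, rfl⟩)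
  refine ⟨IsometryEquiv.mk ⟨f, f', fun x => ?_, fun y => ?_⟩ (Isometry.of_dist_eq fun x y => ?_),
    fun p hp => ?_⟩
  · exact (huniq _ (hf' (f x)) _ (hf x)).2 rfl
  · exact (huniq _ (hf (f' y)) _ (hf' y)).1 rfl
  · exact (hC _ (hf x) _ (hf y)).symm
  · exact (huniq _ (hf p.1) _ (subset_closure hp)).1 rfl

/-- The "forth" step of the back-and-forth; the "back" step is obtained by swapping coordinates. -/
theorem IsUrysohnSphere.exists_insert (hX : IsUrysohnSphere X) {R : Set (X × X)} (hfin : R.Finite)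
    (hR : IsometricRel R) (x : X) : ∃ y, IsometricRel (insert (x, y) R) := by
  have := hfin.to_subtype
  let e := (Finite.equivFin R).symm
  let c : Option (Fin (Nat.card R)) → X := fun o => o.elim x fun i => (e i).1.1
  let φ : Option (Fin (Nat.card R)) → X := fun o => o.elim x fun i => (e i).1.2
  -- Only a pseudometric, since `x` may already be in the domain of `R`. Indexing by `Fin` keeps the
  -- carrier in `Type`, as finite injectivity requires.
  let _ : PseudoMetricSpace (Option (Fin (Nat.card R))) := PseudoMetricSpace.induced c inferInstance
  have hdist : ∀ i j, dist i j = dist (c i) (c j) := fun _ _ => rfl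
  obtain ⟨Φ, hΦ, hΦφ⟩ := hX.exists_isometry_extending (I := Option (Fin (Nat.card R)))
    (fun i j => hX.dist_le_one (c i) (c j)) (range some) φ (by
      rintro _ ⟨i, rfl⟩ _ ⟨j, rfl⟩
      exact (hR _ (e i).2 _ (e j).2).symm)
  have key : ∀ q ∈ R, dist x q.1 = dist (Φ none) q.2 := by
    intro q hq
    obtain ⟨i, hi⟩ := e.surjective ⟨q, hq⟩
    have h1 := hΦ.dist_eq none (some i)
    rw [hΦφ _ ⟨i, rfl⟩, hdist] at h1
    change dist (Φ none) (φ (some i)) = dist x (e i).1.1 at h1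
    have h2 : φ (some i) = (e i).1.2 := rfl
    rw [h2, hi] at h1
    exact h1.symm
  refine ⟨Φ none, ?_⟩
  rintro p (rfl | hp) q (rfl | hq)
  · simp
  · exact key q hq
  · rw [dist_comm, key p hp, dist_comm]
  · exact hR p hp q hq

/-- Ultrahomogeneity: every finite partial isometry of the Urysohn sphere extends to an isometry of
the sphere onto itself. -/
theorem IsUrysohnSphere.exists_isometryEquiv (hX : IsUrysohnSphere X) {R : Set (X × X)}
    (hfin : R.Finite) (hR : IsometricRel R) : ∃ g : X ≃ᵢ X, ∀ p ∈ R, g p.1 = p.2 := by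
  classical
  have := hX.complete
  have := hX.separable
  have := hX.nonempty
  let P := {F : Finset (X × X) // IsometricRel (F : Set (X × X))}
  have hstep : ∀ (F : P) (x : X), ∃ F' : P, F ≤ F' ∧ ∃ y, (x, y) ∈ F'.1 := by
    intro F x
    obtain ⟨y, hy⟩ := hX.exists_insert F.1.finite_toSet F.2 x
    exact ⟨⟨insert (x, y) F.1, by rwa [Finset.coe_insert]⟩, Finset.subset_insert _ _, y,
      Finset.mem_insert_self _ _⟩
  have hstep' : ∀ (F : P) (y : X), ∃ F' : P, F ≤ F' ∧ ∃ x, (x, y) ∈ F'.1 := by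
    intro F y
    obtain ⟨x, hx⟩ := hX.exists_insert (F.1.finite_toSet.preimage
      Prod.swap_injective.injOn) F.2.swap y
    refine ⟨⟨insert (x, y) F.1, ?_⟩, Finset.subset_insert _ _, x, Finset.mem_insert_self _ _⟩
    have h := hx.swap
    rw [Finset.coe_insert]
    convert h using 1
    ext ⟨a, b⟩
    simp [and_comm]
  -- Back-and-forth as genericity: the countably many cofinal conditions say that the `n`-th dense
  -- point is in the domain, or in the range. The union over an ideal meeting all of them is a
  -- partial isometry with dense domain and range.
  let 𝒟 : ℕ ⊕ ℕ → Order.Cofinal P := Sum.elim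
    (fun n => ⟨{F | ∃ y, (TopologicalSpace.denseSeq X n, y) ∈ F.1}, fun F => by
      obtain ⟨F', h, h'⟩ := hstep F (TopologicalSpace.denseSeq X n)
      exact ⟨F', h', h⟩⟩)
    (fun n => ⟨{F | ∃ x, (x, TopologicalSpace.denseSeq X n) ∈ F.1}, fun F => by
      obtain ⟨F', h, h'⟩ := hstep' F (TopologicalSpace.denseSeq X n)
      exact ⟨F', h', h⟩⟩)
  let F₀ : P := ⟨hfin.toFinset, by rwa [hfin.coe_toFinset]⟩
  let J := Order.idealOfCofinals F₀ 𝒟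
  let S : Set (X × X) := {p | ∃ F ∈ J, p ∈ F.1}
  have hS : IsometricRel S := by
    rintro p ⟨F, hF, hp⟩ q ⟨F', hF', hq⟩
    obtain ⟨F'', -, h, h'⟩ := J.directed F hF F' hF'
    exact F''.2 _ (h hp) _ (h' hq)
  obtain ⟨g, hg⟩ := hS.exists_isometryEquiv
    ((TopologicalSpace.denseRange_denseSeq X).mono (by
      rintro _ ⟨n, rfl⟩
      obtain ⟨F, ⟨y, hy⟩, hF⟩ := Order.cofinal_meets_idealOfCofinals F₀ 𝒟 (Sum.inl n)
      exact ⟨_, ⟨F, hF, hy⟩, rfl⟩))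
    ((TopologicalSpace.denseRange_denseSeq X).mono (by
      rintro _ ⟨n, rfl⟩
      obtain ⟨F, ⟨y, hy⟩, hF⟩ := Order.cofinal_meets_idealOfCofinals F₀ 𝒟 (Sum.inr n)
      exact ⟨_, ⟨F, hF, hy⟩, rfl⟩))
  exact ⟨g, fun p hp => hg p ⟨F₀, Order.mem_idealOfCofinals F₀ 𝒟, hfin.mem_toFinset.2 hp⟩⟩

/-- If the distances of `x` and `y` to finitely many points differ by at most `δ`, then some isometry
of the Urysohn sphere takes `x` to `y` and moves each of these points by at most `δ`. -/
theorem IsUrysohnSphere.exists_isometryEquiv_moving (hX : IsUrysohnSphere X) {n : ℕ} (z : Fin n → X)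
    {δ : ℝ} (hδ : 0 ≤ δ) {x y : X} (hxy : ∀ i, |dist x (z i) - dist y (z i)| ≤ δ) :
    ∃ g : X ≃ᵢ X, g x = y ∧ ∀ i, dist (g (z i)) (z i) ≤ δ := by
  -- Distance from `z i` to a new point `w j`, the future image of `z j`. Gluing `x` to `y` and
  -- joining each `z i` to `w i` at cost `δ`, it is the shorter of the route along a `δ`-link and
  -- the route through `y`, cut off at the diameter `1`.
  let D : Fin n → Fin n → ℝ := fun i j =>
    min (min (dist (z i) (z j) + δ) (dist y (z i) + dist x (z j))) 1
  have hD_shift : ∀ i j, D i j ≤ dist (z i) (z j) + δ := fun i j =>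
    (min_le_left _ _).trans (min_le_left _ _)
  have hD_base : ∀ i j, D i j ≤ dist y (z i) + dist x (z j) := fun i j =>
    (min_le_left _ _).trans (min_le_right _ _)
  have hD_one : ∀ i j, D i j ≤ 1 := fun i j => min_le_right _ _
  let c : Option (Fin n) → X := fun o => o.elim y z
  -- Here `inl none` is `y`, `inl (some i)` is `z i` and `inr j` is `w j`; the distance from `y` to
  -- `w j` copies that from `x` to `z j`.
  let d : Option (Fin n) ⊕ Fin n → Option (Fin n) ⊕ Fin n → ℝ := fun p q =>
    match p, q with
    | .inl a, .inl b => dist (c a) (c b)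
    | .inl none, .inr j => dist x (z j)
    | .inr j, .inl none => dist x (z j)
    | .inl (some i), .inr j => D i j
    | .inr j, .inl (some i) => D i j
    | .inr i, .inr j => dist (z i) (z j)
  have hle : ∀ i, dist x (z i) ≤ dist y (z i) + δ := fun i => by
    linarith [(abs_le.1 (hxy i)).2]
  have hle' : ∀ i, dist y (z i) ≤ dist x (z i) + δ := fun i => by
    linarith [(abs_le.1 (hxy i)).1]
  have htri : ∀ p q r, d p r ≤ d p q + d q r := by
    have tx : ∀ i j, dist x (z i) ≤ dist x (z j) + dist (z i) (z j) := fun i j => by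
      rw [dist_comm (z i)]; exact dist_triangle _ _ _
    have ty : ∀ i j, dist y (z i) ≤ dist y (z j) + dist (z i) (z j) := fun i j => by
      rw [dist_comm (z i)]; exact dist_triangle _ _ _
    -- The triangle inequalities are checked according to the branch that attains the minimum on the
    -- larger side.
    have hc : ∀ i j, D i j = dist (z i) (z j) + δ ∨ D i j = dist y (z i) + dist x (z j) ∨
        D i j = 1 := fun i j => by
      rcases min_choice (min (dist (z i) (z j) + δ) (dist y (z i) + dist x (z j))) 1 with h | h
      · rcases min_choice (dist (z i) (z j) + δ) (dist y (z i) + dist x (z j)) with h' | h'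
        · exact Or.inl (h.trans h')
        · exact Or.inr (Or.inl (h.trans h'))
      · exact Or.inr (Or.inr h)
    have htri_left : ∀ i j k, D i j ≤ dist (z i) (z k) + D k j := fun i j k => by
      rcases hc k j with h | h | h <;> rw [h]
      · linarith [hD_shift i j, dist_triangle (z i) (z k) (z j)]
      · linarith [hD_base i j, ty i k]
      · linarith [hD_one i j, dist_nonneg (x := z i) (y := z k)]
    have htri_right : ∀ i j k, D i j ≤ D i k + dist (z k) (z j) := fun i j k => by
      rcases hc i k with h | h | h <;> rw [h]
      · linarith [hD_shift i j, dist_triangle (z i) (z k) (z j)]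
      · linarith [hD_base i j, tx j k, dist_comm (z j) (z k)]
      · linarith [hD_one i j, dist_nonneg (x := z k) (y := z j)]
    -- Triangles `y`, `z i`, `w j`: the hypothesis `hxy` enters here and in `hy_le`, in the branch
    -- of the `δ`-link.
    have hx_le : ∀ i j, dist x (z j) ≤ dist y (z i) + D i j := fun i j => by
      rcases hc i j with h | h | h <;> rw [h]
      · linarith [hle i, tx j i, dist_comm (z j) (z i)]
      · linarith [dist_nonneg (x := y) (y := z i)]
      · linarith [hX.dist_le_one x (z j), dist_nonneg (x := y) (y := z i)]
    have hy_le : ∀ i j, dist y (z i) ≤ D i j + dist x (z j) := fun i j => by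
      rcases hc i j with h | h | h <;> rw [h]
      · linarith [hle' j, ty i j]
      · linarith [dist_nonneg (x := x) (y := z j)]
      · linarith [hX.dist_le_one y (z i), dist_nonneg (x := x) (y := z j)]
    have hle_add_left : ∀ i j k, dist (z j) (z k) ≤ D j i + D k i := fun i j k => by
      have := dist_triangle_right (z j) (z k) (z i)
      have := dist_triangle_left (z j) (z k) y
      have := hX.dist_le_one (z j) (z k)
      have := hy_le j i
      have := hy_le k i
      rcases hc j i with h | h | h <;> rcases hc k i with h' | h' | h' <;>
        linarith [dist_nonneg (x := x) (y := z i), dist_nonneg (x := y) (y := z j),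
          dist_nonneg (x := y) (y := z k), dist_nonneg (x := z k) (y := z i),
          dist_nonneg (x := z j) (y := z i)]
    have hle_add_right : ∀ i j k, dist (z j) (z k) ≤ D i j + D i k := fun i j k => by
      have := dist_triangle_left (z j) (z k) (z i)
      have := dist_triangle_left (z j) (z k) x
      have := hX.dist_le_one (z j) (z k)
      have := hx_le i j
      have := hx_le i k
      rcases hc i j with h | h | h <;> rcases hc i k with h' | h' | h' <;>
        linarith [dist_nonneg (x := y) (y := z i), dist_nonneg (x := x) (y := z j),
          dist_nonneg (x := x) (y := z k), dist_nonneg (x := z i) (y := z j),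
          dist_nonneg (x := z i) (y := z k)]
    rintro ((_ | i) | i) ((_ | j) | j) ((_ | k) | k)
    all_goals simp only [d, c, Option.elim, dist_self, fun i => dist_comm (z i) y]
    all_goals first
      | positivity
      | linarith
      | exact dist_triangle _ _ _
      | linarith [htri_left i k j] | linarith [htri_left k i j, dist_comm (z k) (z j)]
      | linarith [htri_right i k j] | linarith [htri_right k i j, dist_comm (z i) (z j)]
      | linarith [hx_le j k] | linarith [hx_le j i]
      | linarith [hy_le i j] | linarith [hy_le k j]
      | linarith [hle_add_left j i k] | linarith [hle_add_right j i k] | linarith [hD_base i k] | linarith [hD_base k i]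
      | linarith [tx i j] | linarith [tx k j, dist_comm (z k) (z j)]
      | linarith [ty i j] | linarith [ty k j, dist_comm (z k) (z j)]
      | linarith [dist_triangle_left (z i) (z k) x]
      | linarith [dist_triangle_left (z i) (z k) y]
  -- Distinct indices may be at distance zero, as `z` may repeat and `δ` may vanish.
  let _ : PseudoMetricSpace (Option (Fin n) ⊕ Fin n) :=
    { dist := d
      dist_self := by rintro (a | i) <;> simp [d]
      dist_comm := by rintro ((_ | i) | i) ((_ | j) | j) <;> simp [d, dist_comm]
      dist_triangle := htri }
  have hdist : ∀ p q : Option (Fin n) ⊕ Fin n, dist p q = d p q := fun _ _ => rfl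
  obtain ⟨Φ, hΦ, hΦc⟩ := hX.exists_isometry_extending (I := Option (Fin n) ⊕ Fin n)
    (by
      rintro ((_ | i) | i) ((_ | j) | j) <;> rw [hdist] <;>
        first | exact hX.dist_le_one _ _ | exact hD_one _ _)
    (range Sum.inl) (Sum.elim c z) (by
      rintro _ ⟨a, rfl⟩ _ ⟨b, rfl⟩
      rfl)
  have hy : Φ (.inl none) = y := hΦc _ ⟨none, rfl⟩
  have hz : ∀ i, Φ (.inl (some i)) = z i := fun i => hΦc _ ⟨some i, rfl⟩
  obtain ⟨g, hg⟩ := hX.exists_isometryEquiv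
    (R := insert (x, y) (range fun i => (z i, Φ (.inr i)))) ((finite_range _).insert _) (by
      have key : ∀ i, dist x (z i) = dist y (Φ (.inr i)) := fun i => by
        rw [← hy, hΦ.dist_eq]
        rfl
      rintro p (rfl | ⟨i, rfl⟩) q (rfl | ⟨j, rfl⟩)
      · simp
      · exact key j
      · rw [dist_comm, key i, dist_comm]
      · exact (hΦ.dist_eq (.inr i) (.inr j)).symm)
  refine ⟨g, hg _ (mem_insert _ _), fun i => ?_⟩
  rw [hg (z i, Φ (.inr i)) (mem_insert_of_mem _ ⟨i, rfl⟩)]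
  change dist (Φ (.inr i)) (z i) ≤ δ
  rw [← hz, hΦ.dist_eq]
  exact (hD_shift i i).trans (by simp)

end Homogeneity

/-! ### Factoring maps between compacta through continuous functions. -/

section Factor

/-- A map with values in a compact Hausdorff space factors through a dense map to another one as soon
as its compositions with continuous real functions do. -/
theorem exists_continuous_factor {X : Type u} {B : Type t} {K : Type v} [TopologicalSpace B]
    [CompactSpace B] [T2Space B] [TopologicalSpace K] [CompactSpace K] [T2Space K] {β : X → B}
    (hβ : DenseRange β) {μ : X → K}
    (H : ∀ h : C(K, ℝ), ∃ h' : C(B, ℝ), ∀ x, h' (β x) = h (μ x)) :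
    ∃ φ : B → K, Continuous φ ∧ ∀ x, φ (β x) = μ x := by
  -- The factor map has graph `Γ`. The projection of `Γ` to `B` is onto by density and compactness,
  -- and injective because functions on `K` separate points and `H` transfers them to `B`.
  let Γ : Set (B × K) := closure (range fun x => (β x, μ x))
  have hΓ : CompactSpace Γ := isCompact_iff_compactSpace.1 isClosed_closure.isCompact
  have hmem : ∀ x, (β x, μ x) ∈ Γ := fun x => subset_closure ⟨x, rfl⟩
  have hp : Continuous fun q : Γ => q.1.1 := by fun_prop
  have hsurj : Function.Surjective fun q : Γ => q.1.1 := by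
    rw [← range_eq_univ, ← (isCompact_range hp).isClosed.closure_eq]
    refine (hβ.mono ?_).closure_eq
    rintro _ ⟨x, rfl⟩
    exact ⟨⟨_, hmem x⟩, rfl⟩
  have hinj : Function.Injective fun q : Γ => q.1.1 := by
    rintro ⟨⟨b, k⟩, hk⟩ ⟨⟨b', k'⟩, hk'⟩ hb
    obtain rfl : b = b' := hb
    by_contra hne
    have hkk : k ≠ k' := fun h => hne (Subtype.ext (Prod.ext rfl h))
    obtain ⟨h, h0, h1, -⟩ := exists_continuous_zero_one_of_isClosed (isClosed_singleton (x := k))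
      (isClosed_singleton (x := k')) (disjoint_singleton.2 hkk)
    obtain ⟨h', hh'⟩ := H h
    have hext : Γ ⊆ {q : B × K | h' q.1 = h q.2} :=
      closure_minimal (by rintro _ ⟨x, rfl⟩; exact hh' x)
        (isClosed_eq (by fun_prop) (by fun_prop))
    have e1 : h' b = h k := hext hk
    have e2 : h' b = h k' := hext hk'
    rw [e1, h0 rfl, h1 rfl] at e2
    exact zero_ne_one e2
  let e : Γ ≃ₜ B := Continuous.homeoOfEquivCompactToT2
    (f := Equiv.ofBijective _ ⟨hinj, hsurj⟩) hp
  refine ⟨fun b => (e.symm b).1.2, by fun_prop, fun x => ?_⟩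
  have he : e.symm (β x) = ⟨_, hmem x⟩ := by
    rw [Homeomorph.symm_apply_eq]
    rfl
  simp only [he]

variable {G : Type w} [Group G] {X : Type u} [MulAction G X]
  {B : Type t} [TopologicalSpace B] [MulAction G B]
  {K : Type v} [TopologicalSpace K] [MulAction G K] [T2Space K]

theorem map_smul_of_denseRange [ContinuousConstSMul G B] [ContinuousConstSMul G K] {β : X → B}
    {μ : X → K} (hβ : DenseRange β) (hβe : ∀ (g : G) (x : X), β (g • x) = g • β x)
    (hμe : ∀ (g : G) (x : X), μ (g • x) = g • μ x) {φ : B → K} (hφ : Continuous φ)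
    (hφβ : ∀ x, φ (β x) = μ x) (g : G) (b : B) : φ (g • b) = g • φ b := by
  have h : (fun b => φ (g • b)) = fun b => g • φ b := by
    refine hβ.equalizer (by fun_prop) (by fun_prop) ?_
    funext x
    simp only [Function.comp_apply, ← hβe, hφβ, hμe]
  exact congrFun h b

end Factor

/-! ### The Gelfand space of `RUC` as the greatest equivariant compactification. -/

section BetaG

variable {G : Type w} [Group G] [TopologicalSpace G] {X : Type u} [TopologicalSpace X]
  [MulAction G X]

theorem isClosed_RUC : IsClosed (RUC G X : Set (X →ᵇ ℝ)) := by
  refine isClosed_of_closure_subset fun f hf ε hε => ?_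
  obtain ⟨f', hf', hd⟩ := Metric.mem_closure_iff.1 hf (ε / 3) (by positivity)
  obtain ⟨V, hV, h⟩ := hf' (ε / 3) (by positivity)
  refine ⟨V, hV, fun v hv x => ?_⟩
  have h1 := (BoundedContinuousFunction.dist_coe_le_dist (f := f) (g := f') x).trans_lt hd
  have h2 := (BoundedContinuousFunction.dist_coe_le_dist (f := f) (g := f') (v • x)).trans_lt hd
  have h3 := h v hv x
  rw [Real.dist_eq, abs_lt] at h1 h2
  rw [abs_lt] at h3 ⊢
  constructor <;> linarith

theorem completeSpace_RUC : CompleteSpace (RUC G X) :=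
  isClosed_RUC.completeSpace_coe

theorem compactSpace_characterSpace (A : Type*) [NormedRing A] [NormedAlgebra ℝ A]
    [CompleteSpace A] : CompactSpace (WeakDual.characterSpace ℝ A) :=
  inferInstance

instance instCompactSpaceBetaG : CompactSpace (BetaG G X) :=
  @compactSpace_characterSpace (RUC G X) inferInstance inferInstance completeSpace_RUC

/-- Composing an equivariant compactification with a continuous function on it gives a right
uniformly continuous function. -/
theorem IsEquivariantCompactification.mem_RUC {K : Type v} [TopologicalSpace K] [MulAction G K]
    {μ : X → K} (hμ : IsEquivariantCompactification G μ) (h : C(K, ℝ)) {f : X →ᵇ ℝ}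
    (hf : ∀ x, f x = h (μ x)) : f ∈ RUC G X := by
  have := hμ.compactSpace
  have := hμ.continuousSMul
  intro ε hε
  -- Compactness of `K` turns joint continuity at the points `(1, k)` into one neighbourhood of `1`
  -- valid for all `k`.
  have hev : ∀ᶠ g in 𝓝 (1 : G), ∀ k ∈ (univ : Set K), |h (g • k) - h k| < ε := by
    refine isCompact_univ.eventually_forall_of_forall_eventually fun k _ => ?_
    have hc : Continuous fun p : G × K => |h (p.1 • p.2) - h p.2| := by fun_prop
    refine (hc.tendsto (1, k)).eventually_lt_const ?_
    simpa using hε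
  refine ⟨_, hev, fun v hv x => ?_⟩
  rw [hf, hf, hμ.equivariant]
  exact hv _ (mem_univ _)

theorem IsEquivariantCompactification.exists_mem_RUC {K : Type v} [TopologicalSpace K]
    [MulAction G K] {μ : X → K} (hμ : IsEquivariantCompactification G μ) (h : C(K, ℝ)) :
    ∃ f ∈ RUC G X, ∀ x, f x = h (μ x) := by
  have := hμ.compactSpace
  exact ⟨(BoundedContinuousFunction.mkOfCompact h).compContinuous ⟨μ, hμ.continuous⟩,
    hμ.mem_RUC h fun _ => rfl, fun _ => rfl⟩

theorem abs_apply_le_norm_of_norm_one_le {A : Type*} [NormedRing A] [NormedAlgebra ℝ A]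
    [CompleteSpace A] (h1 : ‖(1 : A)‖ ≤ 1) (φ : WeakDual.characterSpace ℝ A) (a : A) :
    |φ a| ≤ ‖a‖ := by
  refine (ContinuousLinearMap.le_opNorm (WeakDual.toStrongDual φ.1) a).trans ?_
  exact mul_le_of_le_one_left (norm_nonneg _)
    ((WeakDual.CharacterSpace.norm_le_norm_one φ).trans h1)

theorem abs_apply_le {φ : BetaG G X} {f : RUC G X} {C : ℝ} (hC : 0 ≤ C)
    (hf : ∀ x, |(f : X →ᵇ ℝ) x| ≤ C) : |φ f| ≤ C := by
  -- An inequality only: the norm of `1` is zero when `X` is empty.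
  have h1 : ‖(1 : X →ᵇ ℝ)‖ ≤ 1 :=
    (BoundedContinuousFunction.norm_le zero_le_one).2 fun x => by simp
  have h2 : ‖(f : X →ᵇ ℝ)‖ ≤ C := (BoundedContinuousFunction.norm_le hC).2 hf
  exact (@abs_apply_le_norm_of_norm_one_le (RUC G X) inferInstance inferInstance completeSpace_RUC
    h1 φ f).trans h2

theorem continuous_betaG_eval (f : RUC G X) : Continuous fun φ : BetaG G X => φ f :=
  (WeakDual.gelfandTransform ℝ (RUC G X) f).continuous

theorem continuous_to_betaG {Y : Type*} [TopologicalSpace Y] {F : Y → BetaG G X}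
    (hF : ∀ f, Continuous fun y => F y f) : Continuous F :=
  Continuous.subtype_mk (f := fun y => (F y : WeakDual ℝ (RUC G X)))
    (WeakDual.continuous_of_continuous_eval hF) _

/-- Suppose a character `φ` is outside the closure. Urysohn's lemma and Stone–Weierstrass give `f`
in `RUC` that is below `1/3` in absolute value on `X` while `φ f > 2/3`, contradicting that
characters are bounded by the sup norm over `X`. -/
theorem denseRange_betaMap : DenseRange (betaMap G : X → BetaG G X) := by
  intro φ
  by_contra hφ
  obtain ⟨h, h0, h1, -⟩ := exists_continuous_zero_one_of_isClosed
    (isClosed_closure (s := range (betaMap G : X → BetaG G X))) (isClosed_singleton (x := φ))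
    (disjoint_singleton_right.2 hφ)
  have hd := ContinuousMap.subalgebra_topologicalClosure_eq_top_of_separatesPoints
    (WeakDual.gelfandTransform ℝ (RUC G X)).range (by
      intro φ ψ hne
      obtain ⟨f, hf⟩ := DFunLike.ne_iff.1 hne
      exact ⟨_, ⟨_, ⟨f, rfl⟩, rfl⟩, hf⟩)
  have hm : h ∈ (WeakDual.gelfandTransform ℝ (RUC G X)).range.topologicalClosure := by
    rw [hd]
    trivial
  obtain ⟨_, ⟨f, rfl⟩, hf⟩ := Metric.mem_closure_iff.1 hm (1 / 3) (by norm_num)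
  have hval : ∀ ψ : BetaG G X, |h ψ - ψ f| < 1 / 3 := fun ψ =>
    (ContinuousMap.dist_apply_le_dist ψ).trans_lt hf
  have hnorm : |φ f| ≤ 1 / 3 := by
    refine abs_apply_le (by norm_num) fun x => ?_
    have hx := hval (betaMap G x)
    rw [h0 (subset_closure ⟨x, rfl⟩), betaMap_apply] at hx
    simpa using hx.le
  have h2 := (abs_le.1 hnorm).2
  have h3 := (abs_lt.1 (hval φ)).2
  rw [h1 rfl] at h3
  norm_num at h3
  linarith

variable [IsTopologicalGroup G] [ContinuousSMul G X]

/-- Writing `g x = (g g₀⁻¹) (g₀ x)` carries the uniform estimate at the identity to `g₀`. This norm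
continuity of orbits, with characters being contractive, makes the action on `BetaG` jointly
continuous. -/
theorem continuous_precompRUC (f : RUC G X) : Continuous fun g : G => precompRUC g f := by
  rw [continuous_iff_continuousAt]
  intro g₀
  rw [ContinuousAt, Metric.tendsto_nhds]
  intro ε hε
  obtain ⟨V, hV, h⟩ := f.2 (ε / 2) (half_pos hε)
  have hc : Continuous fun g : G => g * g₀⁻¹ := by fun_prop
  have ht : Tendsto (fun g : G => g * g₀⁻¹) (𝓝 g₀) (𝓝 1) := by
    simpa using hc.tendsto g₀
  filter_upwards [ht hV] with g hg
  refine lt_of_le_of_lt ?_ (half_lt_self hε)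
  refine (BoundedContinuousFunction.dist_le (half_pos hε).le).2 fun x => ?_
  have h1 := h _ hg (g₀ • x)
  rw [smul_smul, inv_mul_cancel_right] at h1
  exact h1.le

instance instContinuousSMulBetaG : ContinuousSMul G (BetaG G X) where
  continuous_smul := by
    refine continuous_to_betaG fun f => ?_
    rw [continuous_iff_continuousAt]
    rintro ⟨g₀, φ₀⟩
    rw [ContinuousAt, tendsto_iff_dist_tendsto_zero]
    have hc : Continuous fun p : G × BetaG G X =>
        dist (precompRUC p.1 f) (precompRUC g₀ f) +
          dist (p.2 (precompRUC g₀ f)) (φ₀ (precompRUC g₀ f)) :=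
      (((continuous_precompRUC f).comp continuous_fst).dist continuous_const).add
        (((continuous_betaG_eval _).comp continuous_snd).dist continuous_const)
    have h1 := hc.tendsto (g₀, φ₀)
    simp only [dist_self, add_zero] at h1
    refine squeeze_zero (fun _ => dist_nonneg) (fun p => ?_) h1
    change dist (p.2 (precompRUC p.1 f)) (φ₀ (precompRUC g₀ f)) ≤ _
    refine (dist_triangle _ (p.2 (precompRUC g₀ f)) _).trans (add_le_add_left ?_ _)
    rw [Real.dist_eq, ← map_sub]
    exact abs_apply_le dist_nonneg fun x =>
      BoundedContinuousFunction.dist_coe_le_dist (f := (precompRUC p.1 f : X →ᵇ ℝ))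
        (g := (precompRUC g₀ f : X →ᵇ ℝ)) x

theorem isEquivariantCompactification_betaMap :
    IsEquivariantCompactification G (betaMap G : X → BetaG G X) where
  compactSpace := inferInstance
  t2Space := inferInstance
  continuousSMul := inferInstance
  continuous := continuous_to_betaG fun f => f.1.continuous
  equivariant _ _ := rfl
  denseRange := denseRange_betaMap

/-- `β_G X` is the greatest equivariant compactification of any `G`-space `X`. -/
theorem isGreatestEquivariantCompactification_betaMap :
    IsGreatestEquivariantCompactification.{u, v, w, u} G (betaMap G : X → BetaG G X) := by
  refine ⟨isEquivariantCompactification_betaMap, fun K _ _ μ hμ => ?_⟩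
  have := hμ.compactSpace
  have := hμ.t2Space
  have := hμ.continuousSMul
  obtain ⟨φ, hφ, hφβ⟩ := exists_continuous_factor (denseRange_betaMap (G := G) (X := X)) (μ := μ)
    fun h => by
      obtain ⟨f, hf, hfh⟩ := hμ.exists_mem_RUC h
      exact ⟨WeakDual.gelfandTransform ℝ (RUC G X) ⟨f, hf⟩, hfh⟩
  exact ⟨φ, hφ, map_smul_of_denseRange denseRange_betaMap
    isEquivariantCompactification_betaMap.equivariant hμ.equivariant hφ hφβ, hφβ⟩

end BetaG

/-! ### The Gromov compactification of a bounded metric space and its function algebra. -/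

section Gromov

variable {X : Type u} [MetricSpace X]

/-- The map `x ↦ d(x, ·)` on `X` with the precompact replica of its `d`-weak uniformity. -/
def distMap (x : PrecompactWeak X) : X → ℝ := fun z => dist (α := X) x z

theorem dWeakUniformity_eq_comap :
    dWeakUniformity X = UniformSpace.comap (fun x z : X => dist x z) (Pi.uniformSpace fun _ => ℝ) := by
  rw [Pi.uniformSpace_eq, UniformSpace.comap_iInf]
  refine iInf_congr fun z => ?_
  rw [← UniformSpace.comap_comap]
  rfl

/-- The uniformity is pulled back along `x ↦ d(x, ·)`, whose image lies in the compact cube `[0,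
C]^X`. So for a bounded metric the precompact replica changes nothing, and `γX` embeds in `X → ℝ`.
-/
theorem totallyBounded_dWeakUniformity {C : ℝ} (hC : ∀ x y : X, dist x y ≤ C) :
    @TotallyBounded X (dWeakUniformity X) univ := by
  have hi : @IsUniformInducing X (X → ℝ) (dWeakUniformity X) _ (fun x z : X => dist x z) :=
    (@isUniformInducing_iff_uniformSpace X (X → ℝ) (dWeakUniformity X) _ _).2
      dWeakUniformity_eq_comap.symm
  have hK : IsCompact (univ.pi fun _ : X => Icc (0 : ℝ) C) :=
    isCompact_univ_pi fun _ => isCompact_Icc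
  have h := @totallyBounded_preimage X (X → ℝ) (dWeakUniformity X) _ _ _ hi hK.totallyBounded
  have hu : (fun x z : X => dist x z) ⁻¹' (univ.pi fun _ : X => Icc (0 : ℝ) C) = univ :=
    eq_univ_of_forall fun x z _ => ⟨dist_nonneg, hC x z⟩
  rwa [hu] at h

theorem precompactReplica_dWeakUniformity {C : ℝ} (hC : ∀ x y : X, dist x y ≤ C) :
    precompactReplica (dWeakUniformity X) = dWeakUniformity X :=
  le_antisymm
    ((precompactReplica_isLeast _).2 ⟨le_rfl, totallyBounded_dWeakUniformity hC⟩)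
    (precompactReplica_isLeast _).1.1

theorem isUniformInducing_distMap {C : ℝ} (hC : ∀ x y : X, dist x y ≤ C) :
    IsUniformInducing (distMap : PrecompactWeak X → X → ℝ) :=
  isUniformInducing_iff_uniformSpace.2
    ((dWeakUniformity_eq_comap (X := X)).symm.trans (precompactReplica_dWeakUniformity hC).symm)

instance instCompactSpaceGromovCompactification : CompactSpace (GromovCompactification X) := by
  have h1 : TotallyBounded (univ : Set (PrecompactWeak X)) :=
    (precompactReplica_isLeast (dWeakUniformity X)).1.2
  have h2 := (h1.image (UniformSpace.Completion.uniformContinuous_coe (PrecompactWeak X))).closure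
  rw [image_univ, UniformSpace.Completion.denseRange_coe.closure_range] at h2
  exact ⟨isCompact_iff_totallyBounded_isComplete.2 ⟨h2, completeSpace_iff_isComplete_univ.1
    inferInstance⟩⟩

theorem denseRange_gromovMap : DenseRange (gromovMap : X → GromovCompactification X) :=
  UniformSpace.Completion.denseRange_coe (α := PrecompactWeak X)

theorem continuous_gromovMap {C : ℝ} (hC : ∀ x y : X, dist x y ≤ C) :
    Continuous (gromovMap : X → GromovCompactification X) := by
  have h : @Continuous X (PrecompactWeak X) _ _ fun x => x := by
    refine (isUniformInducing_distMap hC).isInducing.continuous_iff.2 ?_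
    exact continuous_pi fun z => continuous_id.dist continuous_const
  exact (UniformSpace.Completion.continuous_coe (PrecompactWeak X)).comp h

theorem gromovMap_smul {G : Type w} [Group G] [MulAction G X] [IsIsometricSMul G X] (g : G)
    (x : X) : gromovMap (g • x) = g • (gromovMap x : GromovCompactification X) :=
  UniformSpace.Completion.coe_smul (X := PrecompactWeak X) g x

/-- The extension to `γX` of the map `x ↦ d(x, ·)`. -/
noncomputable def gromovDist : GromovCompactification X → X → ℝ :=
  UniformSpace.Completion.extension distMap

theorem continuous_gromovDist : Continuous (gromovDist : GromovCompactification X → X → ℝ) :=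
  UniformSpace.Completion.continuous_extension

theorem gromovDist_gromovMap {C : ℝ} (hC : ∀ x y : X, dist x y ≤ C) (x z : X) :
    gromovDist (gromovMap x) z = dist x z :=
  congrFun (UniformSpace.Completion.extension_coe
    (isUniformInducing_distMap hC).uniformContinuous x) z

theorem gromovDist_injective {C : ℝ} (hC : ∀ x y : X, dist x y ≤ C) :
    Function.Injective (gromovDist : GromovCompactification X → X → ℝ) :=
  (UniformSpace.Completion.isUniformInducing_extension (isUniformInducing_distMap hC)).injective

theorem abs_gromovDist_sub_le {C : ℝ} (hC : ∀ x y : X, dist x y ≤ C)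
    (p : GromovCompactification X) (z z' : X) :
    |gromovDist p z - gromovDist p z'| ≤ dist z z' := by
  have hz : ∀ z : X, Continuous fun p : GromovCompactification X => gromovDist p z := fun z =>
    (continuous_apply z).comp continuous_gromovDist
  have hc : IsClosed {p : GromovCompactification X | |gromovDist p z - gromovDist p z'| ≤
      dist z z'} :=
    isClosed_le (((hz z).sub (hz z')).abs) continuous_const
  refine denseRange_gromovMap.induction_on p hc fun x => ?_
  rw [gromovDist_gromovMap hC, gromovDist_gromovMap hC, dist_comm x, dist_comm x]
  exact abs_dist_sub_le _ _ _

/-- Points of `γX` are limits of distance functions, hence 1-Lipschitz functions on `X`, determined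
by their values on a countable dense set `D`. Thus `γX` embeds in the metrizable space `D → ℝ`. -/
theorem metrizableSpace_gromovCompactification [TopologicalSpace.SeparableSpace X] {C : ℝ}
    (hC : ∀ x y : X, dist x y ≤ C) :
    TopologicalSpace.MetrizableSpace (GromovCompactification X) := by
  obtain ⟨D, hDc, hD⟩ := TopologicalSpace.exists_countable_dense X
  have := hDc.to_subtype
  let F : GromovCompactification X → D → ℝ := fun p z => gromovDist p z
  have hF : Continuous F := continuous_pi fun z =>
    (continuous_apply (z : X)).comp continuous_gromovDist
  have hlip : ∀ p : GromovCompactification X, Continuous (gromovDist p) := fun p =>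
    (LipschitzWith.of_dist_le_mul (K := 1) fun z z' => by
      simpa [Real.dist_eq] using abs_gromovDist_sub_le hC p z z').continuous
  have hinj : Function.Injective F := fun p q hpq =>
    gromovDist_injective hC ((hlip p).ext_on hD (hlip q) fun z hz => congrFun hpq ⟨z, hz⟩)
  exact (hF.isClosedEmbedding hinj).isEmbedding.metrizableSpace

theorem isClosed_Gro : IsClosed (Gro X : Set (X →ᵇ ℝ)) :=
  Subalgebra.isClosed_topologicalClosure _

theorem mem_Gro_of_eq_dist {f : X →ᵇ ℝ} {z : X} (hf : ∀ x, f x = dist x z) : f ∈ Gro X :=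
  Subalgebra.le_topologicalClosure _ (Algebra.subset_adjoin ⟨z, hf⟩)

/-- The restriction to `X` of a continuous function on `γX`. -/
noncomputable def gromovRestrict {C : ℝ} (hC : ∀ x y : X, dist x y ≤ C) :
    C(GromovCompactification X, ℝ) →ₐ[ℝ] (X →ᵇ ℝ) where
  toFun h := (BoundedContinuousFunction.mkOfCompact h).compContinuous
    ⟨gromovMap, continuous_gromovMap hC⟩
  map_one' := rfl
  map_mul' _ _ := rfl
  map_zero' := rfl
  map_add' _ _ := rfl
  commutes' _ := rfl

/-- Stone–Weierstrass: the coordinates of `gromovDist` separate the points of `γX` and restrict to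
the functions `d(·, z)`, and restriction is a continuous homomorphism. -/
theorem gromovRestrict_mem_Gro {C : ℝ} (hC : ∀ x y : X, dist x y ≤ C)
    (h : C(GromovCompactification X, ℝ)) : gromovRestrict hC h ∈ Gro X := by
  have hcont : Continuous (gromovRestrict hC) :=
    (BoundedContinuousFunction.continuous_compContinuous _).comp
      (ContinuousMap.isometryEquivBoundedOfCompact _ ℝ).isometry.continuous
  let c : X → C(GromovCompactification X, ℝ) := fun z =>
    ⟨fun p => gromovDist p z, (continuous_apply z).comp continuous_gromovDist⟩
  have hle : Algebra.adjoin ℝ (range c) ≤ (Gro X).comap (gromovRestrict hC) := by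
    refine Algebra.adjoin_le ?_
    rintro _ ⟨z, rfl⟩
    exact mem_Gro_of_eq_dist fun x => gromovDist_gromovMap hC x z
  have hd := ContinuousMap.subalgebra_topologicalClosure_eq_top_of_separatesPoints
    (Algebra.adjoin ℝ (range c)) (by
      intro p q hne
      obtain ⟨z, hz⟩ := Function.ne_iff.1 ((gromovDist_injective hC).ne hne)
      exact ⟨_, ⟨c z, Algebra.subset_adjoin ⟨z, rfl⟩, rfl⟩, hz⟩)
  have hm : h ∈ (Algebra.adjoin ℝ (range c)).topologicalClosure := by
    rw [hd]
    trivial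
  exact closure_minimal (s := (Algebra.adjoin ℝ (range c) : Set C(GromovCompactification X, ℝ)))
    hle (isClosed_Gro.preimage hcont) hm

/-- A bounded function that is uniformly continuous for the `d`-weak uniformity extends to `γX`. -/
theorem exists_extension_gromov (f : X →ᵇ ℝ)
    (hf : dWeakUniformity X ≤ UniformSpace.comap f inferInstance) :
    ∃ h : C(GromovCompactification X, ℝ), ∀ x, h (gromovMap x) = f x := by
  -- Since `f` is bounded, the uniformity it induces is totally bounded, so it is also coarser than
  -- the precompact replica.
  have hi : @IsUniformInducing X ℝ (UniformSpace.comap f inferInstance) _ f :=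
    @IsUniformInducing.mk _ _ (_) (_) _ rfl
  have htb := @totallyBounded_preimage X ℝ (UniformSpace.comap f inferInstance) _ _ _ hi
    (isCompact_closedBall (0 : ℝ) ‖f‖).totallyBounded
  have hu : f ⁻¹' Metric.closedBall 0 ‖f‖ = univ := eq_univ_of_forall fun x => by
    simpa using f.norm_coe_le_norm x
  rw [hu] at htb
  have huc : UniformContinuous fun x : PrecompactWeak X => f (x : X) :=
    uniformContinuous_iff_le_comap.2 ((precompactReplica_isLeast _).2 ⟨hf, htb⟩)
  exact ⟨⟨UniformSpace.Completion.extension fun x : PrecompactWeak X => f (x : X),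
    UniformSpace.Completion.continuous_extension⟩,
    fun x => UniformSpace.Completion.extension_coe huc x⟩

theorem Gro_le_RUC : Gro X ≤ RUC (Iso X) X := by
  refine Subalgebra.topologicalClosure_minimal (Algebra.adjoin_le ?_) isClosed_RUC
  rintro f ⟨z, hf⟩ ε hε
  have hc : Continuous fun v : Iso X => dist (v z) z := (iso_continuous_eval z).dist continuous_const
  have h1 : ∀ᶠ v : Iso X in 𝓝 1, dist (v z) z < ε :=
    (hc.tendsto 1).eventually_lt_const (by simpa using hε)
  refine ⟨_, h1, fun v hv x => ?_⟩
  rw [hf, hf, ← dist_smul v x z, dist_comm _ z, dist_comm _ (v • z)]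
  refine (abs_dist_sub_le _ _ _).trans_lt ?_
  rw [dist_comm]
  exact hv

end Gromov

/-! ### Right uniform continuity on the sphere and the comparison of `β_G X` with `γX`. -/

section Urysohn

variable {X : Type u} [MetricSpace X]

theorem exists_finite_of_mem_nhds_one {V : Set (Iso X)} (hV : V ∈ 𝓝 (1 : Iso X)) :
    ∃ (n : ℕ) (z : Fin n → X) (δ : ℝ), 0 < δ ∧
      ∀ v : Iso X, (∀ i, dist (v (z i)) (z i) ≤ δ) → v ∈ V := by
  rw [nhds_induced, mem_comap] at hV
  obtain ⟨t, ht, htV⟩ := hV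
  rw [nhds_pi, Filter.mem_pi] at ht
  obtain ⟨I, hI, s, hs, hsub⟩ := ht
  choose r hr hrs using fun x => Metric.nhds_basis_closedBall.mem_iff.1 (hs x)
  have := hI.to_subtype
  let e := (Finite.equivFin I).symm
  -- One `δ` below finitely many radii; positivity is requested separately because `I` may be empty.
  obtain ⟨δ, hδ, hδ0⟩ := ((Filter.eventually_all.2 fun i =>
    (Ioc_mem_nhdsGT (hr (e i).1) : ∀ᶠ δ in 𝓝[>] (0 : ℝ), δ ∈ Ioc 0 (r (e i).1))).and
      (self_mem_nhdsWithin (a := (0 : ℝ)) (s := Ioi 0))).exists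
  refine ⟨_, fun i => (e i).1, δ, hδ0, fun v hv => htV (hsub fun x hx => hrs x ?_)⟩
  obtain ⟨i, hi⟩ := e.surjective ⟨x, hx⟩
  have h1 := (hv i).trans (hδ i).2
  simp only [hi] at h1
  exact h1

/-- Homogeneity enters here: the points `z i` and the `δ` that describe a neighbourhood of the
identity in `Iso X` also describe an entourage of the `d`-weak uniformity, and points related by it
differ by an isometry in that neighbourhood. -/
theorem IsUrysohnSphere.dWeakUniformity_le_comap_of_mem_RUC (hX : IsUrysohnSphere X) {f : X →ᵇ ℝ}
    (hf : f ∈ RUC (Iso X) X) : dWeakUniformity X ≤ UniformSpace.comap f inferInstance := by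
  refine (@uniformContinuous_iff_le_comap X ℝ (dWeakUniformity X) _ f).1 ?_
  refine Metric.uniformity_basis_dist.tendsto_right_iff.2 fun ε hε => ?_
  obtain ⟨V, hV, hfV⟩ := hf ε hε
  obtain ⟨n, z, δ, hδ, hz⟩ := exists_finite_of_mem_nhds_one hV
  have hev : ∀ i, ∀ᶠ p in @uniformity X (dWeakUniformity X),
      dist (dist p.1 (z i)) (dist p.2 (z i)) < δ := fun i =>
    (@uniformContinuous_iff_le_comap X ℝ (dWeakUniformity X) _ fun x => dist x (z i)).2
      (iInf_le _ (z i)) (Metric.dist_mem_uniformity hδ)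
  filter_upwards [Filter.eventually_all.2 hev] with p hp
  obtain ⟨g, hg, hgz⟩ := hX.exists_isometryEquiv_moving z hδ.le fun i => (hp i).le
  have h := hfV g (hz g hgz) p.1
  rw [iso_smul_def, hg, abs_sub_comm] at h
  exact h

theorem IsUrysohnSphere.exists_extension_gromov (hX : IsUrysohnSphere X) {f : X →ᵇ ℝ}
    (hf : f ∈ RUC (Iso X) X) :
    ∃ h : C(GromovCompactification X, ℝ), ∀ x, h (gromovMap x) = f x :=
  Urys.exists_extension_gromov f (hX.dWeakUniformity_le_comap_of_mem_RUC hf)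

theorem IsUrysohnSphere.RUC_eq_Gro (hX : IsUrysohnSphere X) : RUC (Iso X) X = Gro X := by
  refine le_antisymm (fun f hf => ?_) Gro_le_RUC
  obtain ⟨h, hh⟩ := hX.exists_extension_gromov hf
  have he : f = gromovRestrict hX.dist_le_one h := by
    ext x
    exact (hh x).symm
  rw [he]
  exact gromovRestrict_mem_Gro _ h

/-- Functions coming from either compactum extend to the other, so each map factors through the
other; the composites are the identity on dense sets. -/
theorem IsUrysohnSphere.equivalentCompactifications_betaMap_gromovMap (hX : IsUrysohnSphere X) :
    EquivalentCompactifications (Iso X) (betaMap (Iso X) : X → BetaG (Iso X) X)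
      (gromovMap : X → GromovCompactification X) := by
  have hβ := isEquivariantCompactification_betaMap (G := Iso X) (X := X)
  obtain ⟨φ, hφ, hφβ⟩ := exists_continuous_factor hβ.denseRange
    (μ := (gromovMap : X → GromovCompactification X)) fun h =>
      ⟨WeakDual.gelfandTransform ℝ (RUC (Iso X) X)
        ⟨_, Gro_le_RUC (gromovRestrict_mem_Gro hX.dist_le_one h)⟩, fun _ => rfl⟩
  obtain ⟨ψ, hψ, hψγ⟩ := exists_continuous_factor (denseRange_gromovMap (X := X))
    (μ := (betaMap (Iso X) : X → BetaG (Iso X) X)) fun h => by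
      obtain ⟨f, hf, hfh⟩ := hβ.exists_mem_RUC h
      obtain ⟨h', hh'⟩ := hX.exists_extension_gromov hf
      exact ⟨h', fun x => (hh' x).trans (hfh x)⟩
  have h1 : ψ ∘ φ = id := hβ.denseRange.equalizer (hψ.comp hφ) continuous_id (by
    funext x
    simp [hφβ, hψγ])
  have h2 : φ ∘ ψ = id := denseRange_gromovMap.equalizer (hφ.comp hψ) continuous_id (by
    funext x
    simp [hφβ, hψγ])
  exact ⟨⟨⟨φ, ψ, congrFun h1, congrFun h2⟩, hφ, hψ⟩,
    map_smul_of_denseRange hβ.denseRange hβ.equivariant gromovMap_smul hφ hφβ, hφβ⟩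

end Urysohn

/-! ### Invariance under equivalence of compactifications. -/

section Transfer

variable {G : Type w} [Group G] [TopologicalSpace G] {X : Type u} [TopologicalSpace X]
  [MulAction G X] {B : Type t} [TopologicalSpace B] [MulAction G B] {K : Type*}
  [TopologicalSpace K] [MulAction G K] {β : X → B} {γ : X → K}

/-- This supplies the joint continuity of the action on `γX`, carried over from `β_G X`. -/
theorem IsEquivariantCompactification.of_equivalent (hβ : IsEquivariantCompactification G β)
    (h : EquivalentCompactifications G β γ) : IsEquivariantCompactification G γ := by
  obtain ⟨e, he, heβ⟩ := h
  have := hβ.compactSpace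
  have := hβ.t2Space
  have := hβ.continuousSMul
  have hγ : γ = e ∘ β := funext fun x => (heβ x).symm
  refine ⟨e.compactSpace, e.t2Space, ⟨?_⟩, ?_, fun g x => ?_, ?_⟩
  · have hc : Continuous fun p : G × K => e (p.1 • e.symm p.2) := by fun_prop
    simpa only [he, Homeomorph.apply_symm_apply] using hc
  · rw [hγ]
    exact e.continuous.comp hβ.continuous
  · rw [← heβ, ← heβ, hβ.equivariant, he]
  · rw [hγ]
    exact e.surjective.denseRange.comp hβ.denseRange e.continuous

theorem IsGreatestEquivariantCompactification.of_equivalent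
    (hβ : IsGreatestEquivariantCompactification.{u, v} G β)
    (h : EquivalentCompactifications G β γ) :
    IsGreatestEquivariantCompactification.{u, v} G γ := by
  refine ⟨hβ.1.of_equivalent h, fun L _ _ μ hμ => ?_⟩
  obtain ⟨e, he, heβ⟩ := h
  obtain ⟨φ, hφ, hφe, hφβ⟩ := hβ.2 L μ hμ
  refine ⟨φ ∘ e.symm, hφ.comp e.symm.continuous, fun g k => ?_, fun x => ?_⟩
  · have hs : e.symm (g • k) = g • e.symm k := by
      rw [e.symm_apply_eq, he, e.apply_symm_apply]
    simp only [Function.comp_apply, hs, hφe]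
  · rw [Function.comp_apply, ← heβ, e.symm_apply_apply, hφβ]

end Transfer

end Urys

theorem theorem3p5 (X : Type u) [MetricSpace X] (hX : Urys.IsUrysohnSphere X) :
    -- `γ : X → γX` is the greatest equivariant compactification of the `Iso(X)`-space `X`
    Urys.IsGreatestEquivariantCompactification.{u, v, u, u} (Urys.Iso X)
        (Urys.gromovMap : X → Urys.GromovCompactification X) ∧
      -- so is `β_G : X → β_G X`, and the two are equivalent
      Urys.IsGreatestEquivariantCompactification.{u, v, u, u} (Urys.Iso X)
        (Urys.betaMap (Urys.Iso X) : X → Urys.BetaG (Urys.Iso X) X) ∧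
      Urys.EquivalentCompactifications (Urys.Iso X)
        (Urys.betaMap (Urys.Iso X) : X → Urys.BetaG (Urys.Iso X) X)
        (Urys.gromovMap : X → Urys.GromovCompactification X) ∧
      -- `β_G X` is metrizable
      TopologicalSpace.MetrizableSpace (Urys.BetaG (Urys.Iso X) X) ∧
      -- `RUC_G(X)` is the closed unital algebra generated by the functions `d(·, z)`
      Urys.RUC (Urys.Iso X) X = Urys.Gro X := by
  have hequiv := hX.equivalentCompactifications_betaMap_gromovMap
  have hβ := Urys.isGreatestEquivariantCompactification_betaMap.{u, v, u} (G := Urys.Iso X) (X := X)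
  refine ⟨hβ.of_equivalent hequiv, hβ, hequiv, ?_, hX.RUC_eq_Gro⟩
  have := hX.separable
  have := Urys.metrizableSpace_gromovCompactification hX.dist_le_one
  obtain ⟨e, -, -⟩ := hequiv
  exact e.isEmbedding.metrizableSpace
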